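/- **Theorem 4.6 (3-marginal smooth conjugate).** Let $n\in\mathbb N$ and $H=\mathbb R^n$ with the Euclidean inner product, let $q=\tfrac12\|\cdot\|^2$, and let $c:H^3\to\mathbb R$ be $c(x_1,x_2,x_3)=\langle x_1,x_2\rangle+\langle x_1,x_3\rangle+\langle x_2,x_3\rangle$. For $\varphi:H\to\,]-\infty,+\infty]$ let $\varphi^*(u)=\sup_x(\langle u,x\rangle-\varphi(x))$ be the Fenchel conjugate, $e_\varphi(s)=\inf_x(\varphi(x)+q(s-x))$ the Moreau envelope, $\partial\varphi$ the subdifferential, and, when it is well defined, $\operatorname{prox}_\varphi(s)$ the unique minimizer of $y\mapsto\varphi(y)+q(y-s)$. Let $g,h:H\to\,]-\infty,+\infty]$ be proper, lower semicontinuous and convex, and let $$f(x)=(g\oplus h)^c(x)=\sup_{y,z\in H}\big(c(x,y,z)-g(y)-h(z)\big),\qquad x\in H.$$ Suppose that $f$ is essentially smooth, i.e. $f$ is a proper convex function, $C=\operatorname{int}\operatorname{dom}f$ is nonempty, $f$ is differentiable on $C$, and $\|\nabla f(x_k)\|\to\infty$ for every sequence $(x_k)$ in $C$ converging to a boundary point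 of $C$. Put $(f_1,f_2,f_3)=(f,g,h)$. Then $c(x_1,x_2,x_3)\le f_1(x_1)+f_2(x_2)+f_3(x_3)$ for all $x_1,x_2,x_3\in H$. Let $\Gamma\subseteq H^3$ be the $c$-splitting set generated by $(f,g,h)$, that is, the set of all $(x_1,x_2,x_3)$ at which equality holds, and for $i\in\{1,2,3\}$ let $A_i:H\rightrightarrows H$ be the mapping with graph $\{(x_i,\sum_{j\ne i}x_j) : (x_1,x_2,x_3)\in\Gamma\}$. Then all of the following hold: 1. there exists $i$ such that $A_i$ is maximally monotone; 2. there exists $i$ such that $A_i=\partial f_i$; 3. $A_i=\partial f_i$ for every $i\in\{1,2,3\}$; 4. $\operatorname{prox}_{f}$, $\operatorname{prox}_{g}$, $\operatorname{prox}_{h}$ are well defined on $H$ and $\operatorname{prox}_{f}+\operatorname{prox}_{g}+\operatorname{prox}_{h}=\mathrm{Id}$; 5. $e_{f^*}+e_{g^*}+e_{h^*}=q$. Moreover, $\Gamma$ is maximally $c$-monotone: it is $c$-monotone and has no proper $c$-monotone extension in $H^3$, where a set $S\subseteq H^3$ is $c$-monotone if for all $(x_1^1,x_2^1,x_3^1),(x_1^2,x_2^2,x_3^2)\in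 S$ and all permutations $\sigma_1,\sigma_2,\sigma_3$ of $\{1,2\}$, $$\sum_{j=1}^2c\big(x_1^{\sigma_1(j)},x_2^{\sigma_2(j)},x_3^{\sigma_3(j)}\big)\le\sum_{j=1}^2c\big(x_1^j,x_2^j,x_3^j\big).$$ -/

import Mathlib

noncomputable section

namespace MultiMarginal

/-! Functions `H → ]-∞, +∞]` are modelled as `EReal`-valued functions; the value `⊥` is excluded by
`IsProper`. Set-valued mappings `A : H ⇉ H` are modelled by their graphs, as subsets of `H × H`. -/

section Functions

variable {H : Type*} [NormedAddCommGroup H] [InnerProductSpace ℝ H]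

/-- `q = ½‖·‖²`. -/
def halfSq (x : H) : ℝ := (1 / 2) * ‖x‖ ^ 2

/-- The effective domain `{x | f x < +∞}`. -/
def effDom (f : H → EReal) : Set H := {x | f x < ⊤}

/-- `f` takes values in `]-∞, +∞]` and is not identically `+∞`. -/
def IsProper (f : H → EReal) : Prop := (∀ x, f x ≠ ⊥) ∧ (effDom f).Nonempty

/-- Convexity of an extended-real-valued function: its epigraph is a convex set. -/
def IsConvexFun (f : H → EReal) : Prop := Convex ℝ {p : H × ℝ | f p.1 ≤ (p.2 : EReal)}

/-- The Fenchel conjugate `f^*(u) = sup_x (⟨u, x⟩ - f x)`. -/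
def fenchelConj (f : H → EReal) (u : H) : EReal := ⨆ x : H, ((inner ℝ u x : ℝ) : EReal) - f x

/-- The Moreau envelope `e_f(s) = inf_x (f x + q (s - x))`. -/
def moreauEnv (f : H → EReal) (s : H) : EReal := ⨅ x : H, f x + (halfSq (s - x) : EReal)

/-- `P` is the proximity operator of `f`: for every `s`, the point `P s` is the unique minimizer of
`y ↦ f y + q (y - s)`. -/
def IsProxOf (f : H → EReal) (P : H → H) : Prop :=
  ∀ s : H, {y : H | ∀ z : H, f y + (halfSq (y - s) : EReal) ≤ f z + (halfSq (z - s) : EReal)} = {P s}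

/-- The graph of the subdifferential of a proper function. -/
def subdiffGraph (f : H → EReal) : Set (H × H) :=
  {p | ∀ y : H, f p.1 + ((inner ℝ p.2 (y - p.1) : ℝ) : EReal) ≤ f y}

/-- Essential smoothness (of a proper convex function on a Euclidean space): with `C = int (dom f)`,
the set `C` is nonempty, `f` is differentiable on `C`, and `‖∇f (x_k)‖ → ∞` for every sequence
`(x_k)` in `C` converging to a boundary point of `C`. -/
def IsEssentiallySmooth [CompleteSpace H] (f : H → EReal) : Prop :=
  IsProper f ∧ IsConvexFun f ∧
  (interior (effDom f)).Nonempty ∧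
  (∀ x ∈ interior (effDom f), DifferentiableAt ℝ (fun y => (f y).toReal) x) ∧
  ∀ (u : ℕ → H) (x : H), (∀ k, u k ∈ interior (effDom f)) → x ∈ frontier (interior (effDom f)) →
    Filter.Tendsto u Filter.atTop (nhds x) →
    Filter.Tendsto (fun k => ‖gradient (fun y => (f y).toReal) (u k)‖) Filter.atTop Filter.atTop

/-- Monotonicity of a set-valued mapping given by its graph. -/
def IsMonotoneGraph (G : Set (H × H)) : Prop :=
  ∀ p ∈ G, ∀ r ∈ G, 0 ≤ (inner ℝ (p.1 - r.1) (p.2 - r.2) : ℝ)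

/-- Maximal monotonicity: the graph is monotone and has no proper monotone extension. -/
def IsMaximallyMonotoneGraph (G : Set (H × H)) : Prop := Maximal IsMonotoneGraph G

end Functions

section Tuples

variable {H : Type*} [NormedAddCommGroup H] [InnerProductSpace ℝ H] {N : ℕ}

/-- The cost `c(x_1, …, x_N) = ∑_{i < j} ⟨x_i, x_j⟩`. -/
def cost (x : Fin N → H) : ℝ := ∑ i, ∑ j ∈ Finset.Ioi i, inner ℝ (x i) (x j)

/-- The inequality `c ≤ f_1 ⊕ ⋯ ⊕ f_N`. -/
def CostLE (f : Fin N → H → EReal) : Prop := ∀ x : Fin N → H, (cost x : EReal) ≤ ∑ i, f i (x i)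

/-- The set of points where `c = f_1 ⊕ ⋯ ⊕ f_N`; under `CostLE f` this is the `c`-splitting set
generated by `(f_1, …, f_N)`. -/
def splittingSet (f : Fin N → H → EReal) : Set (Fin N → H) :=
  {x | (cost x : EReal) = ∑ i, f i (x i)}

/-- `c`-cyclic monotonicity of order `n`. -/
def IsCyclicallyCMonotone (n : ℕ) (Γ : Set (Fin N → H)) : Prop :=
  ∀ x : Fin n → Fin N → H, (∀ j, x j ∈ Γ) → ∀ σ : Fin N → Equiv.Perm (Fin n),
    ∑ j, cost (fun i => x (σ i j) i) ≤ ∑ j, cost (x j)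

/-- `c`-monotonicity, i.e. `c`-cyclic monotonicity of order `2`. -/
def IsCMonotone (Γ : Set (Fin N → H)) : Prop := IsCyclicallyCMonotone 2 Γ

/-- Maximal `c`-monotonicity: `c`-monotone without a proper `c`-monotone extension. -/
def IsMaximallyCMonotone (Γ : Set (Fin N → H)) : Prop := Maximal IsCMonotone Γ

/-- The graph of `A_i`, consisting of the pairs `(x_i, ∑_{j ≠ i} x_j)` with `x ∈ Γ`. -/
def marginalGraph (Γ : Set (Fin N → H)) (i : Fin N) : Set (H × H) :=
  {p | ∃ x ∈ Γ, p = (x i, ∑ j ∈ Finset.univ.erase i, x j)}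

/-- The `c`-conjugate `(g ⊕ h)^c` for three marginals:
`(g ⊕ h)^c (x) = sup_{y, z} (c(x, y, z) - (g y + h z))`. -/
def cConj (g h : H → EReal) (x : H) : EReal :=
  ⨆ (y : H) (z : H), (cost ![x, y, z] : EReal) - (g y + h z)

end Tuples

end MultiMarginal

end

noncomputable section

namespace MultiMarginal

/-! ### Extended-real sums and elementary facts about `halfSq`. -/

section Auxiliary

/-! Everything follows from one surjectivity statement: each `s` is `∑ i, x i` for some `x ∈ Γ`.

Given it, note that the cost is affine in each variable with slope the sum of the others, so `x ∈ Γ`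
forces `s - x i ∈ ∂f_i (x i)`: thus `x i` is the prox of `f_i` at `s`. Summing gives the prox
identity, and evaluating the envelopes at these points gives the envelope identity. Since a
monotonically related pair with the same sum must coincide, Minty's argument gives `A_i = ∂f_i` and
both maximality claims.

For surjectivity (`exists_mem_splittingSet_sum_eq`), let `p` minimize `f + q(· - s)`, so `s - p ∈
∂f(p)`. Essential smoothness puts `p` in the interior of `dom f`
(`IsEssentiallySmooth.mem_interior`). There `f` is bounded above on a ball, which makes the supremum
defining `f p` coercive, hence attained at some `(y, z)` (`exists_cConj_eq`). So `(p, y, z) ∈ Γ` and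
`y + z ∈ ∂f(p)`. As `∂f(p)` is the singleton `{∇f(p)}`, `y + z = s - p`. -/

lemma coe_finset_sum {ι : Type*} (s : Finset ι) (r : ι → ℝ) :
    ((∑ i ∈ s, r i : ℝ) : EReal) = ∑ i ∈ s, (r i : EReal) := by
  induction s using Finset.cons_induction with
  | empty => simp
  | cons a s ha ih => rw [Finset.sum_cons, Finset.sum_cons, EReal.coe_add, ih]

lemma finset_sum_ne_bot {ι : Type*} (s : Finset ι) {a : ι → EReal} (ha : ∀ i, a i ≠ ⊥) :
    ∑ i ∈ s, a i ≠ ⊥ := by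
  induction s using Finset.cons_induction with
  | empty => simp
  | cons i s hi ih => rw [Finset.sum_cons]; simp [EReal.add_eq_bot_iff, ha, ih]

lemma exists_coe_eq {a : EReal} (h : a ≠ ⊥) (h' : a ≠ ⊤) : ∃ r : ℝ, a = r :=
  ⟨a.toReal, (EReal.coe_toReal h' h).symm⟩

variable {H : Type*} [NormedAddCommGroup H]

lemma halfSq_nonneg (x : H) : 0 ≤ halfSq x := by unfold halfSq; positivity

lemma continuous_halfSq : Continuous (halfSq : H → ℝ) := by unfold halfSq; fun_prop

lemma eq_of_halfSq_sub_nonpos {x y : H} (h : halfSq (x - y) ≤ 0) : x = y := by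
  have h1 : ‖x - y‖ ^ 2 ≤ 0 := by unfold halfSq at h; linarith
  have h2 : ‖x - y‖ = 0 := by nlinarith [norm_nonneg (x - y)]
  exact sub_eq_zero.1 (norm_eq_zero.1 h2)

lemma sum_erase_eq_sub {ι : Type*} [Fintype ι] [DecidableEq ι] (x : ι → H) (i : ι) :
    ∑ j ∈ Finset.univ.erase i, x j = ∑ j, x j - x i := by
  rw [← Finset.add_sum_erase _ _ (Finset.mem_univ i), add_sub_cancel_left]

end Auxiliary

/-! ### Splitting sets, and the consequences of surjectivity of the sum map. -/

section Splitting

variable {H : Type*} [NormedAddCommGroup H] [InnerProductSpace ℝ H] {N : ℕ}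

lemma halfSq_add (x y : H) : halfSq (x + y) = halfSq x + inner ℝ x y + halfSq y := by
  simp only [halfSq, norm_add_sq_real]; ring

lemma cost_eq (x : Fin N → H) : cost x = halfSq (∑ i, x i) - ∑ i, halfSq (x i) := by
  have h1 := Finset.sum_sum_Ioi_add_eq_sum_sum_off_diag (fun i j => (inner ℝ (x i) (x j) : ℝ))
  have h2 : ∑ i, ∑ j ∈ Finset.Ioi i, ((inner ℝ (x j) (x i) : ℝ) + inner ℝ (x i) (x j))
      = 2 * cost x := by
    rw [cost, Finset.mul_sum]
    refine Finset.sum_congr rfl fun i _ => ?_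
    rw [Finset.mul_sum]
    refine Finset.sum_congr rfl fun j _ => ?_
    rw [real_inner_comm]; ring
  have h3 : ‖∑ i, x i‖ ^ 2 = ∑ i, ‖x i‖ ^ 2 + 2 * cost x := by
    rw [← real_inner_self_eq_norm_sq, sum_inner, ← h2, h1, ← Finset.sum_add_distrib]
    refine Finset.sum_congr rfl fun i _ => ?_
    rw [inner_sum, ← Finset.add_sum_erase _ _ (Finset.mem_univ i), real_inner_self_eq_norm_sq]
    congr 1
    refine Finset.sum_congr (by ext; simp) fun j _ => real_inner_comm _ _
  simp only [halfSq, ← Finset.mul_sum]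
  linarith

lemma cost_update (x : Fin N → H) (i : Fin N) (y : H) :
    cost (Function.update x i y)
      = cost x + inner ℝ (∑ j ∈ Finset.univ.erase i, x j) (y - x i) := by
  have e1 : ∑ j, Function.update x i y j = y + ∑ j ∈ Finset.univ.erase i, x j := by
    rw [Finset.sum_update_of_mem (Finset.mem_univ i), Finset.sdiff_singleton_eq_erase]
  have e2 : ∑ j, halfSq (Function.update x i y j)
      = halfSq y + ∑ j ∈ Finset.univ.erase i, halfSq (x j) := by
    rw [← Finset.add_sum_erase _ _ (Finset.mem_univ i), Function.update_self]
    congr 1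
    refine Finset.sum_congr rfl fun j hj => ?_
    rw [Function.update_of_ne (Finset.ne_of_mem_erase hj)]
  rw [cost_eq, cost_eq, e1, e2, ← Finset.add_sum_erase _ x (Finset.mem_univ i),
    ← Finset.add_sum_erase _ (fun j => halfSq (x j)) (Finset.mem_univ i), halfSq_add, halfSq_add,
    inner_sub_right, real_inner_comm, real_inner_comm (x i)]
  ring

/-- The values of the generating functions at a point of the splitting set are finite. -/
lemma exists_real_of_mem_splittingSet {F : Fin N → H → EReal} (hbot : ∀ i x, F i x ≠ ⊥)
    {x : Fin N → H} (hx : x ∈ splittingSet F) :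
    ∃ r : Fin N → ℝ, (∀ i, F i (x i) = r i) ∧ cost x = ∑ i, r i := by
  have hx' : (cost x : EReal) = ∑ i, F i (x i) := hx
  have : ∀ i, ∃ r : ℝ, F i (x i) = r := by
    intro i
    refine exists_coe_eq (hbot i _) fun htop => ?_
    rw [← Finset.add_sum_erase _ _ (Finset.mem_univ i), htop, EReal.top_add_of_ne_bot
      (finset_sum_ne_bot _ fun i => hbot i _)] at hx'
    exact EReal.coe_ne_top _ hx'
  choose r hr using this
  refine ⟨r, hr, ?_⟩
  simp only [hr, ← coe_finset_sum] at hx'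
  exact_mod_cast hx'

/-- Vary only the `i`-th coordinate: the cost is affine in it with slope the sum of the others, so
the subgradient inequality is `CostLE` at the varied point minus equality at `x`. -/
lemma mem_subdiffGraph_of_mem_splittingSet {F : Fin N → H → EReal} (hbot : ∀ i x, F i x ≠ ⊥)
    (hle : CostLE F) {x : Fin N → H} (hx : x ∈ splittingSet F) (i : Fin N) :
    (x i, ∑ j ∈ Finset.univ.erase i, x j) ∈ subdiffGraph (F i) := by
  obtain ⟨r, hr, hsum⟩ := exists_real_of_mem_splittingSet hbot hx
  intro y
  dsimp only
  by_cases hy : F i y = ⊤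
  · rw [hy]; exact le_top
  obtain ⟨b, hb⟩ := exists_coe_eq (hbot i y) hy
  have h1 := hle (Function.update x i y)
  have h2 : ∀ j, F j (Function.update x i y j) = (Function.update r i b j : ℝ) := by
    intro j
    rcases eq_or_ne j i with rfl | hj
    · simp [hb]
    · simp [hj, hr]
  simp only [h2, ← coe_finset_sum, EReal.coe_le_coe_iff] at h1
  rw [cost_update, Finset.sum_update_of_mem (Finset.mem_univ i), hsum,
    ← Finset.add_sum_erase _ _ (Finset.mem_univ i), Finset.sdiff_singleton_eq_erase] at h1
  rw [hr i, hb]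
  norm_cast
  linarith

/-- The three-point inequality behind uniqueness of proximal points. -/
lemma halfSq_sub_eq (p s z : H) :
    halfSq (z - s) = halfSq (p - s) - inner ℝ (s - p) (z - p) + halfSq (z - p) := by
  have h : z - s = (p - s) + (z - p) := by abel
  rw [h, halfSq_add, ← neg_sub s p, inner_neg_left]
  ring

/-- The subgradient inequality gives quadratic growth: at `z` the objective exceeds its value at `p`
by at least `halfSq (z - p)`. -/
lemma prox_eq_singleton {f : H → EReal} (hbot : ∀ x, f x ≠ ⊥) {p s : H} {r : ℝ} (hr : f p = r)
    (hp : (p, s - p) ∈ subdiffGraph f) :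
    {y : H | ∀ z : H, f y + (halfSq (y - s) : EReal) ≤ f z + (halfSq (z - s) : EReal)} = {p} := by
  have key : ∀ z : H, ∀ b : ℝ, f z = b → r + halfSq (p - s) + halfSq (z - p) ≤ b + halfSq (z - s) := by
    intro z b hb
    have := hp z
    simp only [hr, hb] at this
    norm_cast at this
    have := halfSq_sub_eq p s z
    linarith
  refine Set.eq_singleton_iff_unique_mem.2 ⟨fun z => ?_, fun y hy => ?_⟩
  · by_cases hz : f z = ⊤
    · rw [hz, EReal.top_add_coe]; exact le_top
    obtain ⟨b, hb⟩ := exists_coe_eq (hbot z) hz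
    have := key z b hb
    have := halfSq_nonneg (z - p)
    rw [hr, hb]
    norm_cast
    linarith
  · have h1 := hy p
    rw [hr] at h1
    have hy' : f y ≠ ⊤ := by
      intro hy'
      rw [hy', EReal.top_add_coe, top_le_iff] at h1
      exact EReal.coe_ne_top _ (by exact_mod_cast h1)
    obtain ⟨b, hb⟩ := exists_coe_eq (hbot y) hy'
    have := key y b hb
    rw [hb] at h1
    norm_cast at h1
    exact eq_of_halfSq_sub_nonpos (by linarith)

/-- The Moreau decomposition, evaluated at the proximal point. -/
lemma moreauEnv_fenchelConj {f : H → EReal} (hbot : ∀ x, f x ≠ ⊥) {p s : H} {r : ℝ} (hr : f p = r)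
    (hp : (p, s - p) ∈ subdiffGraph f) :
    moreauEnv (fenchelConj f) s = ((halfSq p + inner ℝ p (s - p) - r : ℝ) : EReal) := by
  have hconj : ∀ v, ((inner ℝ v p - r : ℝ) : EReal) ≤ fenchelConj f v := by
    intro v
    refine le_iSup_of_le p ?_
    rw [hr, EReal.coe_sub]
  have hq : ∀ v : H, halfSq (s - v) = halfSq p + inner ℝ p (s - p) - inner ℝ v p + halfSq (s - p - v) := by
    intro v
    have h : s - v = p + (s - p - v) := by abel
    rw [h, halfSq_add, real_inner_comm p v, inner_sub_right p (s - p) v]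
    ring
  apply le_antisymm
  · have hval : fenchelConj f (s - p) ≤ ((inner ℝ (s - p) p - r : ℝ) : EReal) := by
      refine iSup_le fun y => ?_
      by_cases hy : f y = ⊤
      · rw [hy, EReal.sub_top]; exact bot_le
      obtain ⟨b, hb⟩ := exists_coe_eq (hbot y) hy
      have := hp y
      simp only [hr, hb] at this
      norm_cast at this
      rw [inner_sub_right (s - p) y p] at this
      rw [hb]
      norm_cast
      linarith
    -- The infimum is attained at the subgradient `s - p`, where Fenchel–Young is an equality.
    refine (iInf_le _ (s - p)).trans ((add_le_add_left hval _).trans ?_)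
    rw [sub_sub_cancel, real_inner_comm p]
    norm_cast
    linarith
  · refine le_iInf fun v => le_trans ?_ (add_le_add_left (hconj v) _)
    have := hq v
    have := halfSq_nonneg (s - p - v)
    norm_cast
    linarith

/-- Each permuted tuple has cost at most its sum of `F i` values; over all tuples these sums are a
rearrangement of the original values, whose total is the original cost. -/
lemma isCMonotone_splittingSet {F : Fin N → H → EReal} (hbot : ∀ i x, F i x ≠ ⊥)
    (hle : CostLE F) : IsCMonotone (splittingSet F) := by
  intro x hx σ
  choose r hr hsum using fun j => exists_real_of_mem_splittingSet hbot (hx j)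
  have h1 : ∀ j, cost (fun i => x (σ i j) i) ≤ ∑ i, r (σ i j) i := by
    intro j
    have := hle (fun i => x (σ i j) i)
    simp only [hr, ← coe_finset_sum] at this
    exact_mod_cast this
  refine (Finset.sum_le_sum fun j _ => h1 j).trans_eq ?_
  rw [Finset.sum_comm]
  simp only [hsum]
  rw [Finset.sum_comm (s := Finset.univ) (t := Finset.univ) (f := fun j i => r j i)]
  exact Finset.sum_congr rfl fun i _ => Equiv.sum_comp (σ i) fun j => r j i

lemma IsCMonotone.inner_nonneg {Γ : Set (Fin N → H)} (hΓ : IsCMonotone Γ) {x y : Fin N → H}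
    (hx : x ∈ Γ) (hy : y ∈ Γ) (i : Fin N) :
    (0 : ℝ) ≤ inner ℝ (x i - y i)
      (∑ j ∈ Finset.univ.erase i, x j - ∑ j ∈ Finset.univ.erase i, y j) := by
  -- Exchange only the `i`-th coordinates of `x` and `y`.
  have h := hΓ ![x, y] (by intro j; fin_cases j <;> simpa)
    (Function.update 1 i (Equiv.swap 0 1))
  have e1 : (fun k => (![x, y] : Fin 2 → Fin N → H)
      ((Function.update 1 i (Equiv.swap 0 1) : Fin N → Equiv.Perm (Fin 2)) k 0) k)
      = Function.update x i (y i) := by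
    funext k
    rcases eq_or_ne k i with rfl | hk
    · simp
    · simp [hk]
  have e2 : (fun k => (![x, y] : Fin 2 → Fin N → H)
      ((Function.update 1 i (Equiv.swap 0 1) : Fin N → Equiv.Perm (Fin 2)) k 1) k)
      = Function.update y i (x i) := by
    funext k
    rcases eq_or_ne k i with rfl | hk
    · simp
    · simp [hk]
  rw [Fin.sum_univ_two, Fin.sum_univ_two, e1, e2, cost_update, cost_update] at h
  simp only [Matrix.cons_val_zero, Matrix.cons_val_one] at h
  rw [real_inner_comm, inner_sub_left]
  rw [← neg_sub (x i), inner_neg_right] at h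
  linarith

/-- Monotonically related pairs with equal sums coincide. -/
lemma eq_of_inner_sub_nonneg {x y s : H} (h : (0 : ℝ) ≤ inner ℝ (x - y) ((s - x) - (s - y))) :
    x = y := by
  apply eq_of_halfSq_sub_nonpos
  have : (s - x) - (s - y) = -(x - y) := by abel
  rw [this, inner_neg_right, real_inner_self_eq_norm_sq] at h
  unfold halfSq
  linarith


lemma effDom_of_mem_subdiffGraph {f : H → EReal} {p : H × H} (hp : p ∈ subdiffGraph f)
    (hf : (effDom f).Nonempty) : f p.1 ≠ ⊤ := by
  obtain ⟨y, hy⟩ := hf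
  intro htop
  have h := hp y
  rw [htop, EReal.top_add_coe, top_le_iff] at h
  exact hy.ne h

lemma subdiffGraph_isMonotone {f : H → EReal} (hf : IsProper f) :
    IsMonotoneGraph (subdiffGraph f) := by
  intro p hp r hr
  obtain ⟨a, ha⟩ := exists_coe_eq (hf.1 _) (effDom_of_mem_subdiffGraph hp hf.2)
  obtain ⟨b, hb⟩ := exists_coe_eq (hf.1 _) (effDom_of_mem_subdiffGraph hr hf.2)
  have h1 := hp r.1
  have h2 := hr p.1
  rw [ha, hb] at h1 h2
  norm_cast at h1 h2
  rw [real_inner_comm, inner_sub_left]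
  rw [← neg_sub, inner_neg_right] at h1
  linarith

lemma subdiff_of_mem_splittingSet {F : Fin N → H → EReal} (hbot : ∀ i x, F i x ≠ ⊥)
    (hle : CostLE F) {x : Fin N → H} (hx : x ∈ splittingSet F) (i : Fin N) :
    (x i, ∑ j, x j - x i) ∈ subdiffGraph (F i) := by
  rw [← sum_erase_eq_sub]
  exact mem_subdiffGraph_of_mem_splittingSet hbot hle hx i

/-- Minty's argument: a pair `(p, u)` in the subdifferential is compared with the pair of the
marginal graph having the same sum `p + u`, and monotonicity makes them equal. -/
lemma marginalGraph_eq_subdiffGraph {F : Fin N → H → EReal} (hF : ∀ i, IsProper (F i))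
    (hle : CostLE F) (hsurj : ∀ s, ∃ x ∈ splittingSet F, ∑ i, x i = s) (i : Fin N) :
    marginalGraph (splittingSet F) i = subdiffGraph (F i) := by
  have hbot : ∀ i x, F i x ≠ ⊥ := fun i => (hF i).1
  apply Set.Subset.antisymm
  · rintro p ⟨x, hx, rfl⟩
    exact mem_subdiffGraph_of_mem_splittingSet hbot hle hx i
  · rintro ⟨p, u⟩ hp
    obtain ⟨x, hx, hsum⟩ := hsurj (p + u)
    have hx' := subdiff_of_mem_splittingSet hbot hle hx i
    rw [hsum] at hx'
    have h := subdiffGraph_isMonotone (hF i) _ hp _ hx'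
    have h' : p = x i := eq_of_inner_sub_nonneg (s := p + u) (by simpa using h)
    refine ⟨x, hx, ?_⟩
    rw [sum_erase_eq_sub, hsum, ← h', add_sub_cancel_left]

lemma isMaximallyMonotone_marginalGraph {F : Fin N → H → EReal} (hF : ∀ i, IsProper (F i))
    (hle : CostLE F) (hsurj : ∀ s, ∃ x ∈ splittingSet F, ∑ i, x i = s) (i : Fin N) :
    IsMaximallyMonotoneGraph (marginalGraph (splittingSet F) i) := by
  refine ⟨?_, fun G hG hsub p hp => ?_⟩
  · rw [marginalGraph_eq_subdiffGraph hF hle hsurj]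
    exact subdiffGraph_isMonotone (hF i)
  · obtain ⟨x, hx, hsum⟩ := hsurj (p.1 + p.2)
    have h := hG p hp _ (hsub ⟨x, hx, rfl⟩)
    rw [sum_erase_eq_sub, hsum] at h
    have h' : p.1 = x i := eq_of_inner_sub_nonneg (s := p.1 + p.2) (by simpa using h)
    refine ⟨x, hx, ?_⟩
    rw [sum_erase_eq_sub, hsum, ← h', add_sub_cancel_left]

lemma exists_isProxOf_sum_eq {F : Fin N → H → EReal} (hbot : ∀ i x, F i x ≠ ⊥)
    (hle : CostLE F) (hsurj : ∀ s, ∃ x ∈ splittingSet F, ∑ i, x i = s) :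
    ∃ P : Fin N → H → H, (∀ i, IsProxOf (F i) (P i)) ∧ ∀ s, ∑ i, P i s = s := by
  choose X hX hsum using hsurj
  refine ⟨fun i s => X s i, fun i s => ?_, hsum⟩
  obtain ⟨r, hr, -⟩ := exists_real_of_mem_splittingSet hbot (hX s)
  have h := subdiff_of_mem_splittingSet hbot hle (hX s) i
  rw [hsum] at h
  exact prox_eq_singleton (hbot i) (hr i) h

/-- At `x ∈ Γ` with sum `s` the envelopes are `⟨x i, s⟩ - q (x i) - r i`; since `∑ r i` is the cost
`q s - ∑ q (x i)`, they add up to `‖s‖² - q s`. -/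
lemma sum_moreauEnv_fenchelConj {F : Fin N → H → EReal} (hbot : ∀ i x, F i x ≠ ⊥)
    (hle : CostLE F) (hsurj : ∀ s, ∃ x ∈ splittingSet F, ∑ i, x i = s) (s : H) :
    ∑ i, moreauEnv (fenchelConj (F i)) s = (halfSq s : EReal) := by
  obtain ⟨x, hx, hsum⟩ := hsurj s
  obtain ⟨r, hr, hcost⟩ := exists_real_of_mem_splittingSet hbot hx
  have h : ∀ i, moreauEnv (fenchelConj (F i)) s
      = ((halfSq (x i) + inner ℝ (x i) (s - x i) - r i : ℝ) : EReal) := by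
    intro i
    have h := subdiff_of_mem_splittingSet hbot hle hx i
    rw [hsum] at h
    exact moreauEnv_fenchelConj (hbot i) (hr i) h
  have hterm : ∀ i, halfSq (x i) + inner ℝ (x i) (s - x i) - r i
      = inner ℝ (x i) s - halfSq (x i) - r i := by
    intro i
    rw [inner_sub_right, real_inner_self_eq_norm_sq]
    unfold halfSq
    ring
  simp only [h, hterm, ← coe_finset_sum]
  rw [Finset.sum_sub_distrib, Finset.sum_sub_distrib, ← hcost, cost_eq, ← sum_inner, hsum,
    real_inner_self_eq_norm_sq]
  norm_cast
  unfold halfSq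
  ring

/-- A `c`-splitting set whose points realize every sum is maximally `c`-monotone. -/
lemma isMaximallyCMonotone_splittingSet {F : Fin N → H → EReal} (hbot : ∀ i x, F i x ≠ ⊥)
    (hle : CostLE F) (hsurj : ∀ s, ∃ x ∈ splittingSet F, ∑ i, x i = s) :
    IsMaximallyCMonotone (splittingSet F) := by
  refine ⟨isCMonotone_splittingSet hbot hle, fun Δ hΔ hsub x hx => ?_⟩
  obtain ⟨y, hy, hsum⟩ := hsurj (∑ i, x i)
  suffices x = y by rwa [this]
  funext i
  have h := IsCMonotone.inner_nonneg hΔ hx (hsub hy) i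
  rw [sum_erase_eq_sub, sum_erase_eq_sub, hsum] at h
  exact eq_of_inner_sub_nonneg h

end Splitting

/-! ### Convex functions, gradients and essential smoothness. -/

section Convex

variable {H : Type*} [NormedAddCommGroup H] [InnerProductSpace ℝ H]

lemma IsConvexFun.le_combo {f : H → EReal} (hf : IsConvexFun f) {x y : H} {a b s t : ℝ}
    (hx : f x ≤ a) (hy : f y ≤ b) (hs : 0 ≤ s) (ht : 0 ≤ t) (hst : s + t = 1) :
    f (s • x + t • y) ≤ ((s * a + t * b : ℝ) : EReal) :=
  hf (x := (x, a)) hx (y := (y, b)) hy hs ht hst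

lemma IsConvexFun.le_segment {f : H → EReal} (hf : IsConvexFun f) {x y : H} {a b t : ℝ}
    (hx : f x ≤ a) (hy : f y ≤ b) (ht : 0 ≤ t) (ht' : t ≤ 1) :
    f (x + t • (y - x)) ≤ ((a + t * (b - a) : ℝ) : EReal) := by
  have h := hf.le_combo hx hy (sub_nonneg.2 ht') ht (by ring)
  convert h using 2
  · rw [smul_sub, sub_smul, one_smul]; abel
  · ring

lemma IsConvexFun.convex_effDom {f : H → EReal} (hf : IsConvexFun f) (hbot : ∀ x, f x ≠ ⊥) :
    Convex ℝ (effDom f) := by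
  intro x hx y hy s t hs ht hst
  obtain ⟨a, ha⟩ := exists_coe_eq (hbot x) (ne_of_lt hx)
  obtain ⟨b, hb⟩ := exists_coe_eq (hbot y) (ne_of_lt hy)
  exact (hf.le_combo ha.le hb.le hs ht hst).trans_lt (EReal.coe_lt_top _)

lemma le_of_forall_small {a b c : ℝ} (h : ∀ t : ℝ, 0 < t → t ≤ 1 → a ≤ b + t * c) : a ≤ b := by
  refine le_of_forall_pos_le_add fun ε hε => ?_
  have hc : 0 < |c| + 1 := by positivity
  have ht : 0 < min 1 (ε / (|c| + 1)) := lt_min one_pos (by positivity)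
  have h1 := h _ ht (min_le_left _ _)
  have h2 : min 1 (ε / (|c| + 1)) * c ≤ min 1 (ε / (|c| + 1)) * (|c| + 1) :=
    mul_le_mul_of_nonneg_left (by linarith [le_abs_self c]) ht.le
  have h3 : min 1 (ε / (|c| + 1)) * (|c| + 1) ≤ ε / (|c| + 1) * (|c| + 1) :=
    mul_le_mul_of_nonneg_right (min_le_right _ _) hc.le
  rw [div_mul_cancel₀ _ hc.ne'] at h3
  linarith

/-- The optimality condition at a minimizer of `f + q(· - s)`. -/
lemma mem_subdiffGraph_of_isMin {f : H → EReal} (hf : IsConvexFun f) (hbot : ∀ x, f x ≠ ⊥)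
    {p s : H} {a : ℝ} (ha : f p = a)
    (hmin : ∀ z, f p + (halfSq (p - s) : EReal) ≤ f z + (halfSq (z - s) : EReal)) :
    (p, s - p) ∈ subdiffGraph f := by
  intro y
  dsimp only
  by_cases hy : f y = ⊤
  · rw [hy]; exact le_top
  obtain ⟨b, hb⟩ := exists_coe_eq (hbot y) hy
  rw [ha, hb]
  norm_cast
  suffices inner ℝ (s - p) (y - p) ≤ b - a by linarith
  -- Minimality is tested along the segment from `p` to `y`; after division by `t` the quadratic
  -- error is `t * halfSq (y - p)`.
  refine le_of_forall_small (c := halfSq (y - p)) fun t ht ht' => ?_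
  have h1 := (hmin (p + t • (y - p))).trans
    (add_le_add_left (hf.le_segment ha.le hb.le ht.le ht') _)
  rw [ha] at h1
  norm_cast at h1
  have h2 := halfSq_sub_eq p s (p + t • (y - p))
  rw [add_sub_cancel_left, inner_smul_right] at h2
  have h3 : halfSq (t • (y - p)) = t ^ 2 * halfSq (y - p) := by
    unfold halfSq
    rw [norm_smul, mul_pow, Real.norm_eq_abs, sq_abs]
    ring
  rw [h3] at h2
  have h4 : t * inner ℝ (s - p) (y - p) ≤ t * (b - a + t * halfSq (y - p)) := by linarith
  exact le_of_mul_le_mul_left h4 ht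

/-- A continuous function is bounded above on a small ball. -/
lemma exists_ball_le {f : H → EReal} (hbot : ∀ x, f x ≠ ⊥) {x : H}
    (hx : x ∈ interior (effDom f)) (hd : DifferentiableAt ℝ (fun y => (f y).toReal) x) :
    ∃ r > 0, ∃ M : ℝ, ∀ d : H, ‖d‖ ≤ r → f (x + d) ≤ M := by
  have h1 : ∀ᶠ y in nhds x, (f y).toReal < (f x).toReal + 1 :=
    hd.continuousAt.eventually_lt continuousAt_const (lt_add_one _)
  obtain ⟨r, hr, hball⟩ := Metric.nhds_basis_closedBall.eventually_iff.1
    (h1.and (mem_interior_iff_mem_nhds.1 hx))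
  refine ⟨r, hr, (f x).toReal + 1, fun d hd' => ?_⟩
  obtain ⟨h2, h3⟩ := hball (x := x + d) (by simpa [Metric.mem_closedBall, dist_eq_norm] using hd')
  obtain ⟨b, hb⟩ := exists_coe_eq (hbot (x + d)) (ne_of_lt h3)
  rw [hb, EReal.toReal_coe] at h2
  rw [hb]
  exact_mod_cast h2.le

lemma exists_norm_le_inner_eq (w : H) {r : ℝ} (hr : 0 ≤ r) :
    ∃ d : H, ‖d‖ ≤ r ∧ (inner ℝ w d : ℝ) = r * ‖w‖ := by
  rcases eq_or_ne w 0 with rfl | hw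
  · exact ⟨0, by simpa using hr, by simp⟩
  have hw' : ‖w‖ ≠ 0 := norm_ne_zero_iff.2 hw
  refine ⟨(r / ‖w‖) • w, ?_, ?_⟩
  · rw [norm_smul, Real.norm_eq_abs, abs_of_nonneg (by positivity), div_mul_cancel₀ _ hw']
  · rw [inner_smul_right, real_inner_self_eq_norm_sq]
    field_simp

variable [CompleteSpace H]

/-- By convexity the difference quotients toward `y` are at most `f y - f x`; pass to the limit. -/
lemma gradient_mem_subdiffGraph {f : H → EReal} (hf : IsConvexFun f) (hbot : ∀ x, f x ≠ ⊥) {x : H}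
    (hx : f x ≠ ⊤) (hd : DifferentiableAt ℝ (fun y => (f y).toReal) x) :
    (x, gradient (fun y => (f y).toReal) x) ∈ subdiffGraph f := by
  intro y
  dsimp only
  by_cases hy : f y = ⊤
  · rw [hy]; exact le_top
  obtain ⟨a, ha⟩ := exists_coe_eq (hbot x) hx
  obtain ⟨b, hb⟩ := exists_coe_eq (hbot y) hy
  rw [ha, hb]
  norm_cast
  have hg := (hasGradientAt_iff_hasFDerivAt.1 hd.hasGradientAt).hasLineDerivAt (y - x)
  have hlim := hg.tendsto_slope_zero_right
  rw [InnerProductSpace.toDual_apply_apply] at hlim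
  have hle : inner ℝ (gradient (fun y => (f y).toReal) x) (y - x) ≤ b - a := by
    refine le_of_tendsto hlim ?_
    filter_upwards [Ioc_mem_nhdsGT (zero_lt_one (α := ℝ))] with t ht
    have h1 := hf.le_segment ha.le hb.le ht.1.le ht.2
    obtain ⟨c, hc⟩ := exists_coe_eq (hbot _) (h1.trans_lt (EReal.coe_lt_top _)).ne
    rw [hc] at h1
    norm_cast at h1
    rw [hc, ha, EReal.toReal_coe, EReal.toReal_coe, smul_eq_mul, inv_mul_le_iff₀ ht.1]
    linarith
  linarith

/-- A subgradient `u` makes `x` a local minimizer of `f - ⟨u, ·⟩`, whose derivative vanishes there.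
-/
lemma eq_gradient_of_mem_subdiffGraph {f : H → EReal} (hbot : ∀ x, f x ≠ ⊥) {x u : H}
    (hx : x ∈ interior (effDom f)) (hd : DifferentiableAt ℝ (fun y => (f y).toReal) x)
    (hu : (x, u) ∈ subdiffGraph f) : u = gradient (fun y => (f y).toReal) x := by
  have hmin : IsLocalMin (fun y => (f y).toReal - inner ℝ u y) x := by
    filter_upwards [mem_interior_iff_mem_nhds.1 hx] with y hy
    obtain ⟨a, ha⟩ := exists_coe_eq (hbot x) (interior_subset hx).ne
    obtain ⟨b, hb⟩ := exists_coe_eq (hbot y) hy.ne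
    have h := hu y
    simp only [ha, hb] at h
    norm_cast at h
    rw [ha, hb, EReal.toReal_coe, EReal.toReal_coe]
    rw [inner_sub_right] at h
    linarith
  have h1 := (hasGradientAt_iff_hasFDerivAt.1 hd.hasGradientAt).sub
    ((InnerProductSpace.toDual ℝ H) u).hasFDerivAt
  have h2 := hmin.hasFDerivAt_eq_zero h1
  rw [sub_eq_zero] at h2
  exact ((InnerProductSpace.toDual ℝ H).injective h2).symm

/-- Subgradients of an essentially smooth function exist only in the interior of its domain. -/
lemma IsEssentiallySmooth.mem_interior {f : H → EReal} (hf : IsEssentiallySmooth f) {x u : H}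
    (hu : (x, u) ∈ subdiffGraph f) : x ∈ interior (effDom f) := by
  obtain ⟨⟨hbot, hne⟩, hconv, ⟨c, hc⟩, hdiff, hblow⟩ := hf
  by_contra hx
  have hxt : f x ≠ ⊤ := effDom_of_mem_subdiffGraph hu hne
  have hxdom : x ∈ effDom f := lt_top_iff_ne_top.2 hxt
  obtain ⟨a, ha⟩ := exists_coe_eq (hbot x) hxt
  obtain ⟨r, hr, M, hM⟩ := exists_ball_le hbot hc (hdiff c hc)
  set y : ℝ → H := fun t => x + t • (c - x) with hy
  -- If `x` is not interior, the gradients must blow up along the segment from an interior point `c`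
  -- to `x`; the subgradient `u` at `x` will bound them instead.
  have hyint : ∀ t : ℝ, 0 < t → t ≤ 1 → y t ∈ interior (effDom f) := fun t ht ht' =>
    (hconv.convex_effDom hbot).add_smul_sub_mem_interior hxdom hc ⟨ht, ht'⟩
  have hlim : Filter.Tendsto (fun k : ℕ => y (1 / ((k : ℝ) + 1))) Filter.atTop (nhds x) := by
    have h1 : Filter.Tendsto y (nhds 0) (nhds (y 0)) := by
      apply Continuous.tendsto; fun_prop
    have h2 := h1.comp (tendsto_one_div_add_atTop_nhds_zero_nat (𝕜 := ℝ))
    simpa [hy, Function.comp_def] using h2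
  have hk : ∀ k : ℕ, (0 : ℝ) < 1 / ((k : ℝ) + 1) ∧ 1 / ((k : ℝ) + 1) ≤ 1 := by
    intro k
    refine ⟨by positivity, ?_⟩
    rw [div_le_one (by positivity)]
    linarith [(Nat.cast_nonneg k : (0 : ℝ) ≤ k)]
  have hmem : ∀ k : ℕ, y (1 / ((k : ℝ) + 1)) ∈ interior (effDom f) :=
    fun k => hyint _ (hk k).1 (hk k).2
  have hfront : x ∈ frontier (interior (effDom f)) := by
    refine ⟨mem_closure_of_tendsto hlim (Filter.Eventually.of_forall hmem), ?_⟩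
    rwa [interior_interior]
  have htend := hblow _ x hmem hfront hlim
  set D : ℝ := inner ℝ u (c - x) with hD
  -- Choose `d` along `v` and test `v` at `c + d`, where `f ≤ M`. With `f (y t) ≥ a + t * D` and, by
  -- monotonicity, `⟨v, c - x⟩ ≥ D`, this gives `r * ‖v‖ ≤ M - a - D`; the stated bound is looser.
  have hbound : ∀ t : ℝ, 0 < t → t ≤ 1 →
      r * ‖gradient (fun z => (f z).toReal) (y t)‖ ≤ M - a + 2 * |D| := by
    intro t ht ht'
    set v := gradient (fun z => (f z).toReal) (y t) with hv
    have hyt := hyint t ht ht'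
    have hvs : (y t, v) ∈ subdiffGraph f :=
      gradient_mem_subdiffGraph hconv hbot (interior_subset hyt).ne (hdiff _ hyt)
    obtain ⟨b, hb⟩ := exists_coe_eq (hbot (y t)) (interior_subset hyt).ne
    have h1 := hu (y t)
    have h2 := hvs x
    obtain ⟨d, hd, hd'⟩ := exists_norm_le_inner_eq v hr.le
    have h3 := (hvs (c + d)).trans (hM d hd)
    have e1 : y t - x = t • (c - x) := by simp [hy]
    have e2 : x - y t = -(t • (c - x)) := by rw [← e1, neg_sub]
    have e3 : c + d - y t = (1 - t) • (c - x) + d := by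
      simp only [hy, sub_smul, one_smul]; abel
    simp only [ha, hb, e1, e2, e3, inner_add_right, inner_neg_right, inner_smul_right, hd'] at h1 h2 h3
    norm_cast at h1 h2 h3
    rw [← hD] at h1
    have h4 : t * D ≤ t * inner ℝ v (c - x) := by linarith
    have h5 : D ≤ inner ℝ v (c - x) := le_of_mul_le_mul_left h4 ht
    have h6 : (1 - t) * D ≤ (1 - t) * inner ℝ v (c - x) :=
      mul_le_mul_of_nonneg_left h5 (sub_nonneg.2 ht')
    linarith [neg_abs_le D, abs_nonneg D]
  obtain ⟨k, hk'⟩ := (htend.eventually_gt_atTop ((M - a + 2 * |D|) / r)).exists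
  rw [div_lt_iff₀ hr] at hk'
  have := hbound _ (hk k).1 (hk k).2
  linarith

end Convex

/-! ### Existence of minimizers by lower semicontinuity and bounded sublevel sets. -/

section Attainment

lemma exists_forall_le_of_isBounded {X : Type*} [PseudoMetricSpace X] [ProperSpace X]
    {Φ : X → EReal} (hΦ : LowerSemicontinuous Φ) (x₀ : X)
    (hb : Bornology.IsBounded {x | Φ x ≤ Φ x₀}) : ∃ p, ∀ x, Φ p ≤ Φ x := by
  have hK : IsCompact {x | Φ x ≤ Φ x₀} :=
    Metric.isCompact_of_isClosed_isBounded (hΦ.isClosed_preimage (Φ x₀)) hb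
  obtain ⟨p, hp, hmin⟩ := LowerSemicontinuousOn.exists_isMinOn ⟨x₀, le_refl (Φ x₀)⟩ hK
    (hΦ.lowerSemicontinuousOn _)
  refine ⟨p, fun x => ?_⟩
  rcases le_total (Φ x) (Φ x₀) with h | h
  · exact hmin h
  · exact le_trans hp h

lemma lowerSemicontinuous_add_coe {X : Type*} [TopologicalSpace X] {Φ : X → EReal}
    (hΦ : LowerSemicontinuous Φ) {k : X → ℝ} (hk : Continuous k) :
    LowerSemicontinuous fun x => Φ x + (k x : EReal) :=
  hΦ.add' (continuous_coe_real_ereal.comp hk).lowerSemicontinuous fun _ =>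
    EReal.continuousAt_add (.inr (EReal.coe_ne_bot _)) (.inr (EReal.coe_ne_top _))

variable {H : Type*} [NormedAddCommGroup H] [InnerProductSpace ℝ H]

/-- Completing the square bounds a point at which an affine function plus `q` is bounded. -/
lemma norm_le_of_inner_add_halfSq_le {a x : H} {K : ℝ} (h : inner ℝ a x + halfSq x ≤ K) :
    ‖x‖ ≤ 2 * ‖a‖ + 1 + 2 * |K| := by
  by_contra! hlt
  have h1 := neg_le_of_abs_le (abs_real_inner_le_norm a x)
  have h2 := le_abs_self K
  unfold halfSq at h
  nlinarith [norm_nonneg a, norm_nonneg x, abs_nonneg K]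

lemma exists_isMin_prox [ProperSpace H] {f : H → EReal} (hf : IsProper f)
    (hlsc : LowerSemicontinuous f) {a : H} {b : ℝ} (hab : ∀ x, ((inner ℝ a x - b : ℝ) : EReal) ≤ f x)
    (s : H) : ∃ p, ∀ z, f p + (halfSq (p - s) : EReal) ≤ f z + (halfSq (z - s) : EReal) := by
  obtain ⟨x₀, hx₀⟩ := hf.2
  obtain ⟨c, hc⟩ := exists_coe_eq (hf.1 x₀) hx₀.ne
  refine exists_forall_le_of_isBounded (lowerSemicontinuous_add_coe hlsc
    (continuous_halfSq.comp (continuous_id.sub continuous_const))) x₀ ?_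
  refine isBounded_iff_forall_norm_le.2
    ⟨2 * ‖a - s‖ + 1 + 2 * |c + halfSq (x₀ - s) + b|, fun x hx => ?_⟩
  apply norm_le_of_inner_add_halfSq_le
  have h1 : f x + (halfSq (x - s) : EReal) ≤ f x₀ + (halfSq (x₀ - s) : EReal) := hx
  have h2 := (add_le_add_left (hab x) _).trans h1
  rw [hc] at h2
  norm_cast at h2
  have h3 := halfSq_add x (-s)
  rw [← sub_eq_add_neg, inner_neg_right, real_inner_comm] at h3
  have h4 := halfSq_nonneg (-s)
  rw [inner_sub_left]
  linarith

end Attainment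

/-! ### Attainment in the `c`-conjugate, and surjectivity of the sum map. -/

section ThreeMarginals

variable {H : Type*} [NormedAddCommGroup H] [InnerProductSpace ℝ H]

lemma cost_three (x y z : H) :
    cost ![x, y, z] = inner ℝ x (y + z) + inner ℝ y z := by
  rw [cost_eq]
  simp only [Fin.sum_univ_three, Matrix.cons_val]
  rw [add_assoc, halfSq_add, halfSq_add]
  ring

lemma cost_sub_le_cConj (g h : H → EReal) (x y z : H) :
    (cost ![x, y, z] : EReal) - (g y + h z) ≤ cConj g h x :=
  le_iSup₂_of_le (f := fun y z => (cost ![x, y, z] : EReal) - (g y + h z)) y z le_rfl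

lemma costLE_cConj {g h : H → EReal} (hg : ∀ x, g x ≠ ⊥) (hh : ∀ x, h x ≠ ⊥)
    (hf : ∀ x, cConj g h x ≠ ⊥) : CostLE ![cConj g h, g, h] := by
  intro x
  have hx : x = ![x 0, x 1, x 2] := by ext i; fin_cases i <;> rfl
  simp only [Fin.sum_univ_three, Matrix.cons_val]
  have h1 := cost_sub_le_cConj g h (x 0) (x 1) (x 2)
  rw [← hx] at h1
  rw [add_assoc]
  exact (EReal.sub_le_iff_le_add (.inl (by simp [EReal.add_eq_bot_iff, hg, hh]))
    (.inr (hf _))).1 h1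

lemma lowerSemicontinuous_cConj (g h : H → EReal) : LowerSemicontinuous (cConj g h) := by
  refine lowerSemicontinuous_iSup fun y => lowerSemicontinuous_iSup fun z => ?_
  simp only [cost_three, sub_eq_add_neg, add_comm (( _ : ℝ) : EReal)]
  exact lowerSemicontinuous_add_coe lowerSemicontinuous_const (by fun_prop)

/-- The supremum defining `cConj g h` is attained where the latter is bounded above on a ball. -/
lemma exists_cConj_eq [ProperSpace H] {g h : H → EReal} (hg : IsProper g) (hh : IsProper h)
    (hg_lsc : LowerSemicontinuous g) (hh_lsc : LowerSemicontinuous h)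
    (hf : IsProper (cConj g h)) {x : H} {r M : ℝ} (hr : 0 < r)
    (hM : ∀ d : H, ‖d‖ ≤ r → cConj g h (x + d) ≤ M) :
    ∃ y z, (cost ![x, y, z] : EReal) = cConj g h x + g y + h z := by
  have hle := costLE_cConj hg.1 hh.1 hf.1
  have hle3 : ∀ x y z, (cost ![x, y, z] : EReal) ≤ cConj g h x + g y + h z := fun x y z => by
    simpa [Fin.sum_univ_three] using hle ![x, y, z]
  obtain ⟨x₁, hx₁⟩ := hf.2
  obtain ⟨y₁, hy₁⟩ := hg.2
  obtain ⟨z₁, hz₁⟩ := hh.2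
  obtain ⟨a₁, ha₁⟩ := exists_coe_eq (hf.1 x₁) hx₁.ne
  obtain ⟨b₁, hb₁⟩ := exists_coe_eq (hg.1 y₁) hy₁.ne
  obtain ⟨c₁, hc₁⟩ := exists_coe_eq (hh.1 z₁) hz₁.ne
  have hfin : ∀ y z, g y + h z ≠ ⊥ := fun y z => by simp [EReal.add_eq_bot_iff, hg.1, hh.1]
  set Φ : H × H → EReal := fun p => (g p.1 + h p.2) + ((-cost ![x, p.1, p.2] : ℝ) : EReal) with hΦ
  have hΦlsc : LowerSemicontinuous Φ := by
    refine lowerSemicontinuous_add_coe ?_ ?_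
    · exact (hg_lsc.comp continuous_fst).add' (hh_lsc.comp continuous_snd) fun p =>
        EReal.continuousAt_add (.inr (hh.1 _)) (.inl (hg.1 _))
    · simp only [cost_three]; fun_prop
  set m : ℝ := b₁ + c₁ - cost ![x, y₁, z₁] with hm
  have hΦ₁ : Φ (y₁, z₁) = m := by
    simp only [hΦ, hb₁, hc₁]
    norm_cast
  obtain ⟨⟨y, z⟩, hmin⟩ : ∃ p, ∀ q, Φ p ≤ Φ q := by
    refine exists_forall_le_of_isBounded hΦlsc (y₁, z₁) ?_
    -- On the sublevel set, testing `cConj` at `x + d` with `d` along `y + z` gives `‖y + z‖ ≤ R`.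
    set R : ℝ := (M + m) / r with hR
    -- `CostLE` at `(x₁, y, z₁)` and `(x₁, y₁, z)` gives affine minorants of `g` and `h` with slopes
    -- `x₁ + z₁` and `x₁ + y₁`. Writing `⟨y, z⟩ = q (y + z) - q y - q z` moves both squares to the
    -- left, leaving a bound `K` free of `y` and `z`.
    set K : ℝ := m + ‖x‖ * R + R ^ 2 / 2 + (a₁ + c₁) - inner ℝ x₁ z₁ + (a₁ + b₁) - inner ℝ x₁ y₁
      with hK
    set K' : ℝ := K + halfSq (x₁ + z₁) + halfSq (x₁ + y₁) with hK'
    refine isBounded_iff_forall_norm_le.2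
      ⟨max (2 * ‖x₁ + z₁‖ + 1 + 2 * |K'|) (2 * ‖x₁ + y₁‖ + 1 + 2 * |K'|), ?_⟩
    rintro ⟨y, z⟩ hyz
    rw [Set.mem_ofPred_eq, hΦ₁] at hyz
    have hsum : g y + h z ≠ ⊤ := by
      intro htop
      simp only [hΦ, htop, EReal.top_add_coe, top_le_iff] at hyz
      exact EReal.coe_ne_top _ hyz
    have hgy : g y ≠ ⊤ := fun htop => hsum (by rw [htop, EReal.top_add_of_ne_bot (hh.1 z)])
    have hhz : h z ≠ ⊤ := fun htop => hsum (by rw [htop, EReal.add_top_of_ne_bot (hg.1 y)])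
    obtain ⟨b, hb⟩ := exists_coe_eq (hg.1 y) hgy
    obtain ⟨c, hc⟩ := exists_coe_eq (hh.1 z) hhz
    simp only [hΦ, hb, hc] at hyz
    norm_cast at hyz
    have h1 := hle3 x₁ y z₁
    have h2 := hle3 x₁ y₁ z
    rw [ha₁, hb, hc₁] at h1
    rw [ha₁, hb₁, hc] at h2
    norm_cast at h1 h2
    obtain ⟨d, hd, hd'⟩ := exists_norm_le_inner_eq (y + z) hr.le
    have h3 := cost_sub_le_cConj g h (x + d) y z
    have h3 := h3.trans (hM d hd)
    rw [hb, hc] at h3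
    norm_cast at h3
    rw [cost_three] at h1 h2 h3 hyz
    rw [inner_add_left, real_inner_comm (y + z) d, hd'] at h3
    have hw : ‖y + z‖ ≤ R := by
      rw [hR, le_div_iff₀ hr]; linarith
    have hw' : ‖y + z‖ ^ 2 ≤ R ^ 2 := pow_le_pow_left₀ (norm_nonneg _) hw 2
    have h4 : (inner ℝ x (y + z) : ℝ) ≤ ‖x‖ * R :=
      (real_inner_le_norm _ _).trans (mul_le_mul_of_nonneg_left hw (norm_nonneg _))
    have h5 := halfSq_add y z
    have h5' : halfSq (y + z) = 1 / 2 * ‖y + z‖ ^ 2 := rfl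
    have h6 : (inner ℝ (x₁ + z₁) y + halfSq y) + (inner ℝ (x₁ + y₁) z + halfSq z) ≤ K := by
      rw [inner_add_left, inner_add_left, real_inner_comm y z₁]
      rw [inner_add_right] at h1 h2
      linarith
    -- Bounds either summand of `h6` below, so that the other is at most `K'`.
    have h7 : ∀ u v : H, -halfSq u ≤ inner ℝ u v + halfSq v := by
      intro u v
      have := halfSq_add u v
      have := halfSq_nonneg (u + v)
      linarith
    have h8 := h7 (x₁ + z₁) y
    have h9 := h7 (x₁ + y₁) z
    have h10 := halfSq_nonneg (x₁ + z₁)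
    have h11 := halfSq_nonneg (x₁ + y₁)
    rw [Prod.norm_def]
    exact max_le_max (norm_le_of_inner_add_halfSq_le (by linarith))
      (norm_le_of_inner_add_halfSq_le (by linarith))
  refine ⟨y, z, le_antisymm (hle3 x y z) ?_⟩
  have hm₁ := hmin (y₁, z₁)
  rw [hΦ₁] at hm₁
  have hsum : g y + h z ≠ ⊤ := by
    intro htop
    simp only [hΦ, htop, EReal.top_add_coe, top_le_iff] at hm₁
    exact EReal.coe_ne_top _ hm₁
  obtain ⟨k, hk⟩ := exists_coe_eq (hfin y z) hsum
  rw [add_assoc, hk]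
  suffices cConj g h x ≤ ((cost ![x, y, z] - k : ℝ) : EReal) by
    refine (add_le_add_left this _).trans ?_
    norm_cast
    linarith
  refine iSup₂_le fun y' z' => ?_
  by_cases htop : g y' + h z' = ⊤
  · rw [htop, EReal.sub_top]; exact bot_le
  obtain ⟨k', hk'⟩ := exists_coe_eq (hfin y' z') htop
  have := hmin (y', z')
  simp only [hΦ, hk, hk'] at this
  norm_cast at this
  rw [hk']
  norm_cast
  linarith

/-- If the `c`-conjugate `f` of `(g, h)` is essentially smooth, then every point of the space is
the sum of a point of the splitting set of `(f, g, h)`. -/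
lemma exists_mem_splittingSet_sum_eq [ProperSpace H] [CompleteSpace H] {g h : H → EReal}
    (hg : IsProper g) (hh : IsProper h)
    (hg_lsc : LowerSemicontinuous g) (hh_lsc : LowerSemicontinuous h)
    (hf : IsEssentiallySmooth (cConj g h)) (s : H) :
    ∃ x ∈ splittingSet ![cConj g h, g, h], ∑ i, x i = s := by
  have hprop := hf.1
  have hconv := hf.2.1
  have hdiff := hf.2.2.2.1
  have hle := costLE_cConj hg.1 hh.1 hprop.1
  have hbot : ∀ i x, (![cConj g h, g, h] : Fin 3 → H → EReal) i x ≠ ⊥ := by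
    intro i; fin_cases i
    exacts [hprop.1, hg.1, hh.1]
  obtain ⟨y₁, hy₁⟩ := hg.2
  obtain ⟨z₁, hz₁⟩ := hh.2
  obtain ⟨b₁, hb₁⟩ := exists_coe_eq (hg.1 y₁) hy₁.ne
  obtain ⟨c₁, hc₁⟩ := exists_coe_eq (hh.1 z₁) hz₁.ne
  -- Freezing `(y₁, z₁)` in the supremum yields an affine minorant, which makes the prox objective
  -- coercive.
  have hminor : ∀ x, ((inner ℝ (y₁ + z₁) x - (b₁ + c₁ - inner ℝ y₁ z₁) : ℝ) : EReal)
      ≤ cConj g h x := by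
    intro x
    refine le_trans ?_ (cost_sub_le_cConj g h x y₁ z₁)
    rw [hb₁, hc₁, cost_three, real_inner_comm]
    norm_cast
    linarith
  obtain ⟨p, hp⟩ := exists_isMin_prox hprop (lowerSemicontinuous_cConj g h) hminor s
  obtain ⟨x₀, hx₀⟩ := hprop.2
  have hpt : cConj g h p ≠ ⊤ := by
    intro htop
    have := hp x₀
    rw [htop, EReal.top_add_coe, top_le_iff] at this
    exact (EReal.add_lt_top hx₀.ne (EReal.coe_ne_top _)).ne this
  obtain ⟨a, ha⟩ := exists_coe_eq (hprop.1 p) hpt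
  have hsub := mem_subdiffGraph_of_isMin hconv hprop.1 ha hp
  have hpint := hf.mem_interior hsub
  obtain ⟨r, hr, M, hM⟩ := exists_ball_le hprop.1 hpint (hdiff p hpint)
  obtain ⟨y, z, hyz⟩ := exists_cConj_eq hg hh hg_lsc hh_lsc hprop hr hM
  have hmem : ![p, y, z] ∈ splittingSet ![cConj g h, g, h] := by
    simpa [splittingSet, Fin.sum_univ_three] using hyz
  refine ⟨_, hmem, ?_⟩
  have hsub' := subdiff_of_mem_splittingSet hbot hle hmem 0
  have e1 := eq_gradient_of_mem_subdiffGraph hprop.1 hpint (hdiff p hpint) hsub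
  have e2 := eq_gradient_of_mem_subdiffGraph hprop.1 hpint (hdiff p hpint) hsub'
  -- Both `s - p` and the total minus `p` are subgradients at `p`, hence equal to the gradient.
  exact sub_left_injective (b := p) (e2.trans e1.symm)

end ThreeMarginals

end MultiMarginal

end

/-! ### The theorem, assembled from surjectivity. -/

open MultiMarginal in
theorem theorem4p6 (n : ℕ) (f g h : EuclideanSpace ℝ (Fin n) → EReal)
    (hg : IsProper g) (hg_lsc : LowerSemicontinuous g) (hg_conv : IsConvexFun g)
    (hh : IsProper h) (hh_lsc : LowerSemicontinuous h) (hh_conv : IsConvexFun h)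
    (hf : f = cConj g h) (hf_smooth : IsEssentiallySmooth f)
    (F : Fin 3 → EuclideanSpace ℝ (Fin n) → EReal) (hF : F = ![f, g, h])
    (Γ : Set (Fin 3 → EuclideanSpace ℝ (Fin n))) (hΓ : Γ = splittingSet F) :
    -- the tuple does generate a `c`-splitting set
    CostLE F ∧
    -- (i)
    (∃ i, IsMaximallyMonotoneGraph (marginalGraph Γ i)) ∧
    -- (ii)
    (∃ i, marginalGraph Γ i = subdiffGraph (F i)) ∧
    -- (iii)
    (∀ i, marginalGraph Γ i = subdiffGraph (F i)) ∧
    -- (iv)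
    (∃ P : Fin 3 → EuclideanSpace ℝ (Fin n) → EuclideanSpace ℝ (Fin n),
      (∀ i, IsProxOf (F i) (P i)) ∧ ∀ s, ∑ i, P i s = s) ∧
    -- (v)
    (∀ s, moreauEnv (fenchelConj f) s + moreauEnv (fenchelConj g) s + moreauEnv (fenchelConj h) s
      = (halfSq s : EReal)) ∧
    IsMaximallyCMonotone Γ := by
  have hsurj : ∀ s, ∃ x ∈ splittingSet F, ∑ i, x i = s := by
    subst hF hf
    exact exists_mem_splittingSet_sum_eq hg hh hg_lsc hh_lsc hf_smooth
  have hle : CostLE F := by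
    subst hF hf
    exact costLE_cConj hg.1 hh.1 hf_smooth.1.1
  have hprop : ∀ i, IsProper (F i) := by
    subst hF
    intro i; fin_cases i
    exacts [hf_smooth.1, hg, hh]
  have hbot : ∀ i x, F i x ≠ ⊥ := fun i => (hprop i).1
  have henv := sum_moreauEnv_fenchelConj hbot hle hsurj
  subst hΓ
  refine ⟨hle, ⟨0, isMaximallyMonotone_marginalGraph hprop hle hsurj 0⟩,
    ⟨0, marginalGraph_eq_subdiffGraph hprop hle hsurj 0⟩,
    marginalGraph_eq_subdiffGraph hprop hle hsurj,
    exists_isProxOf_sum_eq hbot hle hsurj, fun s => ?_,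
    isMaximallyCMonotone_splittingSet hbot hle hsurj⟩
  have := henv s
  subst hF
  simpa [Fin.sum_univ_three] using this
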